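/- Let $n\ge 2$ and $c\ge 1$ be integers. Let $UV_n(c)$ be the universal virtual braid group: the group with generators $\sigma_{i,t}$ and $\rho_i$ ($1\le i\le n-1$, $1\le t\le c$) and defining relations - $\rho_i\rho_{i+1}\rho_i=\rho_{i+1}\rho_i\rho_{i+1}$ for $1\le i\le n-2$; - $\rho_i\rho_j=\rho_j\rho_i$ for $|i-j|\ge 2$; - $\rho_i^2=1$ for $1\le i\le n-1$; - $\sigma_{i,t}\sigma_{j,\ell}=\sigma_{j,\ell}\sigma_{i,t}$ for $|i-j|\ge 2$ and $1\le t,\ell\le c$; - $\sigma_{i,t}\rho_j=\rho_j\sigma_{i,t}$ for $|i-j|\ge 2$ and $1\le t\le c$; - $\rho_i\rho_{i+1}\sigma_{i,t}=\sigma_{i+1,t}\rho_i\rho_{i+1}$ for $1\le i\le n-2$ and $1\le t\le c$. Let $s_i=(i\ \ i+1)\in S_n$. Let $PUV_n(c)$ be the kernel of the homomorphism $UV_n(c)\to S_n$ with $\sigma_{i,t}\mapsto s_i$ and $\rho_i\mapsto s_i$, and let $KUV_n(c)$ be the kernel of the homomorphism $UV_n(c)\to S_n$ with $\sigma_{i,t}\mapsto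 1$ and $\rho_i\mapsto s_i$. A group is called subgroup separable (LERF) if each of its finitely generated subgroups is closed in the profinite topology, that is, the topology having the cosets of the finite-index subgroups as a basis. A group is called virtually free if it has a free subgroup of finite index. Let $F_2$ be the free group of rank $2$. Then: 1. $UV_n(c)$ is subgroup separable if and only if $n=2$ or $n=3$. 2. $PUV_n(c)$ is subgroup separable if and only if $n=2$ or $n=3$. 3. If $n\le 3$, then $UV_n(c)$ is virtually free. 4. If $n\ge 4$, then $KUV_n(c)$ contains a subgroup isomorphic to $F_2\times F_2$. 5. The group $F_2\times F_2$ is not subgroup separable. -/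

import Mathlib

open Topology

namespace UnivVirtualBraid

/-- Generators of `UV_n(c)`: the crossings `σ_{i,t}` and the virtual crossings `ρ_i`, where
`i` ranges over `n - 1` values and `t` over `c` values (indices start at `0`). -/
inductive Gen (n c : ℕ) : Type
  | sigma (i : Fin (n - 1)) (t : Fin c) : Gen n c
  | rho (i : Fin (n - 1)) : Gen n c

/-- `|i - j| ≥ 2`. -/
def Far {m : ℕ} (i j : Fin m) : Prop := (i : ℕ) + 2 ≤ j ∨ (j : ℕ) + 2 ≤ i

/-- The free generator `σ_{i,t}`. -/
def freeSigma {n c : ℕ} (i : Fin (n - 1)) (t : Fin c) : FreeGroup (Gen n c) :=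
  FreeGroup.of (Gen.sigma i t)

/-- The free generator `ρ_i`. -/
def freeRho {n : ℕ} (c : ℕ) (i : Fin (n - 1)) : FreeGroup (Gen n c) :=
  FreeGroup.of (Gen.rho i)

/-- The defining relations of `UV_n(c)`: `IsRelation u v` means that `u = v` is imposed. -/
inductive IsRelation (n c : ℕ) : FreeGroup (Gen n c) → FreeGroup (Gen n c) → Prop
  | pr1 (i j : Fin (n - 1)) (h : (i : ℕ) + 1 = j) :
      IsRelation n c (freeRho c i * freeRho c j * freeRho c i)
        (freeRho c j * freeRho c i * freeRho c j)
  | pr2 (i j : Fin (n - 1)) (h : Far i j) :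
      IsRelation n c (freeRho c i * freeRho c j) (freeRho c j * freeRho c i)
  | pr3 (i : Fin (n - 1)) : IsRelation n c (freeRho c i ^ 2) 1
  | cr (i j : Fin (n - 1)) (t l : Fin c) (h : Far i j) :
      IsRelation n c (freeSigma i t * freeSigma j l) (freeSigma j l * freeSigma i t)
  | mr1 (i j : Fin (n - 1)) (t : Fin c) (h : Far i j) :
      IsRelation n c (freeSigma i t * freeRho c j) (freeRho c j * freeSigma i t)
  | mr2 (i j : Fin (n - 1)) (t : Fin c) (h : (i : ℕ) + 1 = j) :
      IsRelation n c (freeRho c i * freeRho c j * freeSigma i t)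
        (freeSigma j t * freeRho c i * freeRho c j)

/-- The relators `u v⁻¹` of `UV_n(c)`. -/
def relators (n c : ℕ) : Set (FreeGroup (Gen n c)) :=
  {w | ∃ u v, IsRelation n c u v ∧ w = u * v⁻¹}

/-- The universal virtual braid group `UV_n(c)`. -/
abbrev UV (n c : ℕ) : Type := PresentedGroup (relators n c)

/-- The transposition `s_i = (i  i+1)` of the symmetric group on `n` letters. -/
def adjSwap {n : ℕ} (i : Fin (n - 1)) : Equiv.Perm (Fin n) :=
  Equiv.swap ⟨i, by omega⟩ ⟨i + 1, by omega⟩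

/-- The images of the generators under `π_n^P`: `σ_{i,t} ↦ s_i`, `ρ_i ↦ s_i`. -/
def genP {n c : ℕ} : Gen n c → Equiv.Perm (Fin n)
  | Gen.sigma i _ => adjSwap i
  | Gen.rho i => adjSwap i

/-- The images of the generators under `π_n^K`: `σ_{i,t} ↦ 1`, `ρ_i ↦ s_i`. -/
def genK {n c : ℕ} : Gen n c → Equiv.Perm (Fin n)
  | Gen.sigma _ _ => 1
  | Gen.rho i => adjSwap i

theorem adjSwap_sq {n : ℕ} (i : Fin (n - 1)) : adjSwap i ^ 2 = 1 := by
  rw [pow_two]; exact Equiv.swap_mul_self _ _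

theorem adjSwap_comm {n : ℕ} (i j : Fin (n - 1)) (h : Far i j) :
    adjSwap i * adjSwap j = adjSwap j * adjSwap i := by
  unfold Far at h
  ext x
  simp only [adjSwap, Equiv.Perm.mul_apply, Equiv.swap_apply_def, Fin.ext_iff]
  grind

theorem adjSwap_braid {n : ℕ} (i j : Fin (n - 1)) (h : (i : ℕ) + 1 = j) :
    adjSwap i * adjSwap j * adjSwap i = adjSwap j * adjSwap i * adjSwap j := by
  ext x
  simp only [adjSwap, Equiv.Perm.mul_apply, Equiv.swap_apply_def, Fin.ext_iff]
  grind

theorem genP_relators (n c : ℕ) :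
    ∀ r ∈ relators n c, FreeGroup.lift (genP (n := n) (c := c)) r = 1 := by
  rintro r ⟨u, v, h, rfl⟩
  rw [map_mul, map_inv, mul_inv_eq_one]
  induction h with
  | pr1 i j h => simpa [freeRho, genP] using adjSwap_braid i j h
  | pr2 i j h => simpa [freeRho, genP] using adjSwap_comm i j h
  | pr3 i => simpa [freeRho, genP] using adjSwap_sq i
  | cr i j t l h => simpa [freeSigma, genP] using adjSwap_comm i j h
  | mr1 i j t h => simpa [freeRho, freeSigma, genP] using adjSwap_comm i j h
  | mr2 i j t h => simpa [freeRho, freeSigma, genP] using adjSwap_braid i j h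

theorem genK_relators (n c : ℕ) :
    ∀ r ∈ relators n c, FreeGroup.lift (genK (n := n) (c := c)) r = 1 := by
  rintro r ⟨u, v, h, rfl⟩
  rw [map_mul, map_inv, mul_inv_eq_one]
  induction h with
  | pr1 i j h => simpa [freeRho, genK] using adjSwap_braid i j h
  | pr2 i j h => simpa [freeRho, genK] using adjSwap_comm i j h
  | pr3 i => simpa [freeRho, genK] using adjSwap_sq i
  | cr i j t l h => simp [freeSigma, genK]
  | mr1 i j t h => simp [freeRho, freeSigma, genK]
  | mr2 i j t h => simp [freeRho, freeSigma, genK]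

/-- The homomorphism `π_n^P : UV_n(c) → S_n`, `σ_{i,t} ↦ s_i`, `ρ_i ↦ s_i`. -/
def piP (n c : ℕ) : UV n c →* Equiv.Perm (Fin n) :=
  PresentedGroup.toGroup (genP_relators n c)

/-- The homomorphism `π_n^K : UV_n(c) → S_n`, `σ_{i,t} ↦ 1`, `ρ_i ↦ s_i`. -/
def piK (n c : ℕ) : UV n c →* Equiv.Perm (Fin n) :=
  PresentedGroup.toGroup (genK_relators n c)

/-- The pure universal virtual braid group `PUV_n(c) = ker π_n^P`. -/
def PUV (n c : ℕ) : Subgroup (UV n c) := (piP n c).ker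

/-- The kernel universal virtual braid group `KUV_n(c) = ker π_n^K`. -/
def KUV (n c : ℕ) : Subgroup (UV n c) := (piK n c).ker

/-- The profinite topology on a group: the topology generated by the cosets of the
finite-index subgroups (these cosets form a basis of it). -/
abbrev profiniteTopology (G : Type*) [Group G] : TopologicalSpace G :=
  TopologicalSpace.generateFrom
    {s | ∃ (H : Subgroup G) (g : G), H.FiniteIndex ∧ s = (fun x => g * x) '' (H : Set G)}

/-- A group is LERF (subgroup separable) if every finitely generated subgroup is closed in the
profinite topology. -/
def IsLERF (G : Type*) [Group G] : Prop :=
  ∀ H : Subgroup G, H.FG → IsClosed[profiniteTopology G] (H : Set G)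

/-- A group is virtually free if it has a free subgroup of finite index. -/
def IsVirtuallyFree (G : Type*) [Group G] : Prop :=
  ∃ H : Subgroup G, H.FiniteIndex ∧ IsFreeGroup H

end UnivVirtualBraid

/-! Subgroup separability passes to subgroups and to finite-index overgroups, and free groups have
it by Marshall Hall's theorem, so virtually free groups are subgroup separable, while a group
containing a non-separable subgroup is not.

For `n ≤ 3` no two indices are far apart, so the only relation on the crossings is the mixed one,
which makes every `σ_{i,t}` a conjugate of `σ_{1,t}` by virtual crossings. Hence `UV_n(c)` embeds in
a semidirect product of a free group with the finite group `W` generated by the `ρ_i`, and is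
virtually free (`isVirtuallyFree_UV`).

For `n ≥ 4`, `σ_{1,t}` and `ρ_1 σ_{1,t} ρ_1` commute with `σ_{3,t}` and `ρ_3 σ_{3,t} ρ_3`. An action
on ordered pairs decorated by `F₂` shows that these elements generate `F₂ × F₂` inside the kernel
(`exists_freeGroup_prod_injective_KUV`).

`F₂ × F₂` is not separable by a fibre-product argument over the Baumslag–Solitar group `BS(2,3)`,
which is not residually finite (`not_isLERF_freeGroup_prod`). For `PUV_n(c)`, finite index suffices.
-/

namespace UnivVirtualBraid

/-! ### The profinite topology and inheritance of separability -/

section Separability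

variable {G : Type*} [Group G]

theorem exists_finiteIndex_forall_mul_mem {U : Set G} (hU : IsOpen[profiniteTopology G] U) :
    ∀ x ∈ U, ∃ N : Subgroup G, N.FiniteIndex ∧ ∀ y ∈ N, x * y ∈ U := by
  change TopologicalSpace.GenerateOpen _ U at hU
  induction hU with
  | basic s hs =>
    obtain ⟨H, g, hH, rfl⟩ := hs
    rintro _ ⟨h, hh, rfl⟩
    exact ⟨H, hH, fun y hy => ⟨h * y, H.mul_mem hh hy, (mul_assoc _ _ _).symm⟩⟩
  | univ => exact fun x _ => ⟨⊤, inferInstance, fun _ _ => trivial⟩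
  | inter s t _ _ ihs iht =>
    rintro x ⟨hs, ht⟩
    obtain ⟨M, hM, hMs⟩ := ihs x hs
    obtain ⟨N, hN, hNt⟩ := iht x ht
    exact ⟨M ⊓ N, inferInstance, fun y hy => ⟨hMs y hy.1, hNt y hy.2⟩⟩
  | sUnion S _ ih =>
    rintro x ⟨s, hs, hx⟩
    obtain ⟨N, hN, h⟩ := ih s hs x hx
    exact ⟨N, hN, fun y hy => ⟨s, hs, h y hy⟩⟩

theorem isClosed_profiniteTopology_iff {A : Set G} :
    IsClosed[profiniteTopology G] A ↔
      ∀ g ∉ A, ∃ N : Subgroup G, N.FiniteIndex ∧ ∀ y ∈ N, g * y ∉ A := by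
  let := profiniteTopology G
  rw [← isOpen_compl_iff]
  refine ⟨fun h g hg => exists_finiteIndex_forall_mul_mem h g hg, fun h => ?_⟩
  rw [isOpen_iff_forall_mem_open]
  intro g hg
  obtain ⟨N, hN, hy⟩ := h g hg
  refine ⟨(fun x => g * x) '' (N : Set G), ?_,
    TopologicalSpace.isOpen_generateFrom_of_mem ⟨N, g, hN, rfl⟩, 1, N.one_mem, mul_one g⟩
  rintro _ ⟨y, hyN, rfl⟩
  exact hy y hyN

/-- If `gN` misses `H`, then adjoining the normal core of `N` to `H` gives a finite-index subgroup
that still omits `g`. -/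
theorem isLERF_iff :
    IsLERF G ↔ ∀ H : Subgroup G, H.FG → ∀ g ∉ H,
      ∃ K : Subgroup G, K.FiniteIndex ∧ H ≤ K ∧ g ∉ K := by
  refine forall₂_congr fun H _ => isClosed_profiniteTopology_iff.trans (forall₂_congr fun g _ => ?_)
  constructor
  · rintro ⟨N, hN, h⟩
    refine ⟨H ⊔ N.normalCore, Subgroup.finiteIndex_of_le le_sup_right, le_sup_left, fun hg => ?_⟩
    obtain ⟨x, hx, y, hy, rfl⟩ := Subgroup.mem_sup_of_normal_right.1 hg
    exact h y⁻¹ (N.inv_mem (N.normalCore_le hy)) (by simpa using hx)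
  · rintro ⟨K, hK, hHK, hg⟩
    exact ⟨K, hK, fun y hy hgy => hg ((K.mul_mem_cancel_right hy).1 (hHK hgy))⟩

theorem fg_map {G' : Type*} [Group G'] {H : Subgroup G} (hH : H.FG) (f : G →* G') :
    (H.map f).FG := by
  classical
  obtain ⟨S, rfl⟩ := hH
  exact ⟨S.image f, by rw [MonoidHom.map_closure, Finset.coe_image]⟩

theorem fg_of_fg_map {G' : Type*} [Group G'] {H : Subgroup G} {f : G →* G'}
    (hf : Function.Injective f) (hH : (H.map f).FG) : H.FG :=
  (Subgroup.fg_iff_submonoid_fg H).2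
    (Submonoid.FG.map_injective f hf ((Subgroup.fg_iff_submonoid_fg _).1 hH))

theorem finiteIndex_comap {G' : Type*} [Group G'] (f : G' →* G) (K : Subgroup G)
    [K.FiniteIndex] : (K.comap f).FiniteIndex :=
  ⟨by rw [Subgroup.index_comap]; exact (Subgroup.instFiniteIndex_subgroupOf K f.range).1⟩

theorem IsLERF.of_injective {G' : Type*} [Group G'] (hG : IsLERF G) (f : G' →* G)
    (hf : Function.Injective f) : IsLERF G' := by
  rw [isLERF_iff] at hG ⊢
  intro H hH g hg
  obtain ⟨K, hK, hle, hgK⟩ := hG (H.map f) (fg_map hH f) (f g)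
    (by rwa [Subgroup.mem_map_iff_mem hf])
  exact ⟨K.comap f, finiteIndex_comap f K, Subgroup.map_le_iff_le_comap.1 hle, hgK⟩

/-- `H ⊓ K` has finite index in `H`, so it is finitely generated and closed; `H` is a finite union
of its left translates. -/
theorem IsLERF.of_finiteIndex {K : Subgroup G} [hKi : K.FiniteIndex] (hK : IsLERF K) :
    IsLERF G := by
  rw [isLERF_iff] at hK
  intro H hH
  rw [isClosed_profiniteTopology_iff]
  intro g hg
  have : Group.FG H := (Group.fg_iff_subgroup_fg H).2 hH
  have hfg : ((K.subgroupOf H).map H.subtype).FG :=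
    fg_map ((Group.fg_iff_subgroup_fg _).1 (Subgroup.fg_of_index_ne_zero (K.subgroupOf H))) _
  rw [Subgroup.subgroupOf_map_subtype] at hfg
  have hfg' : (H.subgroupOf K).FG := by
    refine fg_of_fg_map K.subtype_injective ?_
    rwa [Subgroup.subgroupOf_map_subtype, inf_comm]
  have key : ∀ x ∉ H, ∃ N : Subgroup G, N.FiniteIndex ∧ ∀ y ∈ N, x * y ∉ H ⊓ K := by
    intro x hx
    by_cases hxK : x ∈ K
    · obtain ⟨L, hL, hle, hxL⟩ := hK _ hfg' ⟨x, hxK⟩ (by simpa [Subgroup.mem_subgroupOf] using hx)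
      refine ⟨L.map K.subtype, ⟨?_⟩, ?_⟩
      · rw [Subgroup.index_map_subtype]
        exact mul_ne_zero hL.1 hKi.1
      · rintro _ ⟨y, hy, rfl⟩ hxy
        have h : (⟨x, hxK⟩ : K) * y ∈ L := hle (Subgroup.mem_subgroupOf.2 hxy.1)
        exact hxL ((L.mul_mem_cancel_right hy).1 h)
    · exact ⟨K, hKi, fun y hy h => hxK ((K.mul_mem_cancel_right hy).1 h.2)⟩
  -- One neighbourhood per coset of `H ⊓ K` in `H`: each translate `q⁻¹ g` stays outside `H`, so
  -- `key` applies, and finitely many `N q` are intersected.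
  choose! N hN hNx using fun q : H ⧸ K.subgroupOf H =>
    key ((q.out : G)⁻¹ * g) (by rwa [H.mul_mem_cancel_left (H.inv_mem q.out.2)])
  refine ⟨⨅ q, N q, Subgroup.finiteIndex_iInf hN, fun y hy hgy => ?_⟩
  let q : H ⧸ K.subgroupOf H := QuotientGroup.mk ⟨g * y, hgy⟩
  refine hNx q y (Subgroup.mem_iInf.1 hy q) ⟨?_, ?_⟩
  · rw [mul_assoc]
    exact H.mul_mem (H.inv_mem q.out.2) hgy
  · have h := QuotientGroup.eq.1 (QuotientGroup.out_eq' q)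
    rw [Subgroup.mem_subgroupOf] at h
    simpa [mul_assoc] using h

end Separability

/-! ### Marshall Hall's theorem -/

section FreeGroups

variable {X : Type*}

/-- The action of an element of a free group at one point depends on finitely many values of the
generators. -/
theorem exists_finset_lift_apply_eq {Ω : Type*} (σ : X → Equiv.Perm Ω) (w : FreeGroup X) :
    ∀ p : Ω, ∃ S : Set Ω, S.Finite ∧ ∀ τ : X → Equiv.Perm Ω,
      (∀ x, ∀ q ∈ S, σ x q ∈ S → τ x q = σ x q) →
        FreeGroup.lift τ w p = FreeGroup.lift σ w p := by
  induction w using FreeGroup.induction_on with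
  | C1 => exact fun p => ⟨∅, Set.finite_empty, fun τ _ => by simp⟩
  | of x =>
    exact fun p => ⟨{p, σ x p}, by simp, fun τ h => by simpa using h x p (by simp) (by simp)⟩
  | inv_of x _ =>
    refine fun p => ⟨{p, (σ x)⁻¹ p}, by simp, fun τ h => ?_⟩
    have := h x ((σ x)⁻¹ p) (by simp) (by simp)
    simp only [map_inv, FreeGroup.lift_apply_of]
    rw [Equiv.Perm.inv_eq_iff_eq, this]
    simp
  | mul u v hu hv =>
    intro p
    obtain ⟨S, hS, hSτ⟩ := hv p
    obtain ⟨T, hT, hTτ⟩ := hu (FreeGroup.lift σ v p)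
    refine ⟨S ∪ T, hS.union hT, fun τ h => ?_⟩
    simp only [map_mul, Equiv.Perm.mul_apply]
    rw [hSτ τ fun x q hq hq' => h x q (.inl hq) (.inl hq'),
      hTτ τ fun x q hq hq' => h x q (.inr hq) (.inr hq')]

/-- A permutation agrees on a finite set, as far as it stays in it, with a permutation of that
finite set. -/
theorem exists_perm_subtype_apply_eq {Ω : Type*} (S : Set Ω) [Finite S] (σ : Equiv.Perm Ω) :
    ∃ τ : Equiv.Perm S, ∀ q : S, ∀ h : σ q ∈ S, τ q = ⟨σ q, h⟩ := by
  classical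
  have := Fintype.ofFinite S
  let e : {q : S // σ q ∈ S} ≃ {q : S // σ⁻¹ q ∈ S} :=
    { toFun := fun q => ⟨⟨σ q.1, q.2⟩, by simp⟩
      invFun := fun q => ⟨⟨σ⁻¹ q.1, q.2⟩, by simp⟩
      left_inv := fun q => by simp
      right_inv := fun q => by simp }
  exact ⟨e.extendSubtype, fun q h => e.extendSubtype_apply_of_mem q h⟩

/-- Marshall Hall's theorem: free groups are subgroup separable. -/
theorem isLERF_freeGroup : IsLERF (FreeGroup X) := by
  classical
  rw [isLERF_iff]
  rintro H ⟨B, rfl⟩ g hg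
  set H := Subgroup.closure (B : Set (FreeGroup X))
  let Ω := FreeGroup X ⧸ H
  let act := MulAction.toPermHom (FreeGroup X) Ω
  let σ : X → Equiv.Perm Ω := fun x => act (FreeGroup.of x)
  have hσ : FreeGroup.lift σ = act := FreeGroup.ext_hom _ _ fun x => by simp [σ]
  let p : Ω := QuotientGroup.mk 1
  have hp : ∀ w, FreeGroup.lift σ w p = p ↔ w ∈ H := fun w => by
    rw [hσ]
    change (QuotientGroup.mk (w * 1) : Ω) = QuotientGroup.mk 1 ↔ _
    rw [mul_one, eq_comm, QuotientGroup.eq]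
    simp
  choose S hS hSτ using fun w => exists_finset_lift_apply_eq σ w p
  -- The finite piece of the Schreier coset graph that controls the paths from the base coset
  -- spelled by `g` and by the generators of `H`.
  let C : Set Ω := {p} ∪ ⋃ w ∈ insert g B, S w
  have hC : C.Finite := (Set.finite_singleton p).union
    ((insert g B).finite_toSet.biUnion fun w _ => hS w)
  have hCS : ∀ w ∈ insert g B, S w ⊆ C := fun w hw =>
    (Set.subset_biUnion_of_mem (u := S) hw).trans Set.subset_union_right
  have : Finite C := hC
  choose τ hτ using fun x => exists_perm_subtype_apply_eq C (σ x)
  let f : FreeGroup X →* Equiv.Perm C := FreeGroup.lift τ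
  -- Extending by the identity outside `C` gives permutations of `Ω` itself, which can be compared
  -- with `σ` along these paths.
  let τ' : X → Equiv.Perm Ω := fun x => Equiv.Perm.ofSubtype (τ x)
  have hf : ∀ w, FreeGroup.lift τ' w = Equiv.Perm.ofSubtype (f w) := fun w =>
    DFunLike.congr_fun (FreeGroup.ext_hom (FreeGroup.lift τ')
      (Equiv.Perm.ofSubtype.comp f) fun x => by simp [τ', f]) w
  have hagree : ∀ w ∈ insert g B, ((f w ⟨p, .inl rfl⟩ : C) : Ω) = FreeGroup.lift σ w p := by
    intro w hw
    rw [← hSτ w τ', hf, Equiv.Perm.ofSubtype_apply_of_mem _ (show p ∈ C from .inl rfl)]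
    intro x q hq hq'
    rw [Equiv.Perm.ofSubtype_apply_of_mem _ (hCS w hw hq), hτ x ⟨q, hCS w hw hq⟩ (hCS w hw hq')]
  refine ⟨(MulAction.stabilizer (Equiv.Perm C) (⟨p, .inl rfl⟩ : C)).comap f,
    finiteIndex_comap f _, ?_, ?_⟩
  · rw [Subgroup.closure_le]
    intro b hb
    exact Subtype.ext ((hagree b (Finset.mem_insert_of_mem hb)).trans
      ((hp b).2 (Subgroup.subset_closure hb)))
  · intro h
    refine hg ((hp g).1 ?_)
    rw [← hagree g (Finset.mem_insert_self g B)]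
    exact congrArg Subtype.val (MulAction.mem_stabilizer_iff.1 (Subgroup.mem_comap.1 h))

theorem IsVirtuallyFree.isLERF {G : Type*} [Group G] (h : IsVirtuallyFree G) : IsLERF G := by
  obtain ⟨H, hH, hfree⟩ := h
  exact (isLERF_freeGroup.of_injective (IsFreeGroup.toFreeGroup H).toMonoidHom
    (IsFreeGroup.toFreeGroup H).injective).of_finiteIndex

end FreeGroups

/-! ### Non-separability of `F₂ × F₂` -/

section BaumslagSolitar

/-- In a group in which `a` has finite order, the relation `t a² t⁻¹ = a³` forces `t a t⁻¹` to
commute with `a`. -/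
theorem commute_conj_of_isOfFinOrder {G : Type*} [Group G] {a t : G} (ha : IsOfFinOrder a)
    (h : t * a ^ 2 * t⁻¹ = a ^ 3) : Commute (t * a * t⁻¹) a := by
  -- Conjugates have equal order, so `gcd(ord a, 2) = gcd(ord a, 3)`, which forces `ord a` to be
  -- odd; then `a` is a power of `a²`, and its conjugate by `t` is a power of `a³`.
  have hord : orderOf (a ^ 2) = orderOf (a ^ 3) := by
    rw [← h, ← MulAut.conj_apply]
    exact ((MulAut.conj t).orderOf_eq _).symm
  have hpos := ha.orderOf_pos
  have hcop : Nat.Coprime (orderOf a) 2 := by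
    rw [orderOf_pow' a two_ne_zero, orderOf_pow' a three_ne_zero] at hord
    have h2 := (Nat.dvd_prime Nat.prime_two).1 (Nat.gcd_dvd_right (orderOf a) 2)
    have h3 := (Nat.dvd_prime Nat.prime_three).1 (Nat.gcd_dvd_right (orderOf a) 3)
    have d2 := Nat.gcd_dvd_left (orderOf a) 2
    have d3 := Nat.gcd_dvd_left (orderOf a) 3
    rcases h2 with h2 | h2
    · exact h2
    · rcases h3 with h3 | h3 <;> rw [h2, h3] at hord <;> rw [h2] at d2 <;> rw [h3] at d3 <;> omega
  obtain ⟨k, hk⟩ := exists_pow_eq_self_of_coprime hcop.symm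
  have : t * a * t⁻¹ = (a ^ 3) ^ k := by
    have hk' : t * a * t⁻¹ = t * (a ^ 2) ^ k * t⁻¹ := by rw [hk]
    rw [hk', ← conj_pow, h]
  rw [this]
  exact ((Commute.refl a).pow_left 3).pow_left k

/-- The translation `(x, y) ↦ (x + 1, y)` of `ℤ × ℤ`. -/
def bsTranslation : Equiv.Perm (ℤ × ℤ) where
  toFun p := (p.1 + 1, p.2)
  invFun p := (p.1 - 1, p.2)
  left_inv p := by simp
  right_inv p := by simp

/-- A permutation of `ℤ × ℤ` conjugating the square of the translation to its cube. -/
def bsConjugator : Equiv.Perm (ℤ × ℤ) where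
  -- Orbits of the squared translation are numbered by `2y + x % 2`, with position `x / 2`; those of
  -- the cube by `3y + x % 3`, with position `x / 3`. The map preserves number and position.
  toFun p := (3 * (p.1 / 2) + (2 * p.2 + p.1 % 2) % 3, (2 * p.2 + p.1 % 2) / 3)
  invFun p := (2 * (p.1 / 3) + (3 * p.2 + p.1 % 3) % 2, (3 * p.2 + p.1 % 3) / 2)
  left_inv p := by ext <;> simp only <;> omega
  right_inv p := by ext <;> simp only <;> omega

theorem bsConjugator_conj_sq :
    bsConjugator * bsTranslation ^ 2 * bsConjugator⁻¹ = bsTranslation ^ 3 := by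
  rw [mul_inv_eq_iff_eq_mul]
  ext p <;> simp only [bsConjugator, bsTranslation, pow_succ, pow_zero, one_mul,
    Equiv.Perm.mul_apply, Equiv.coe_fn_mk] <;> omega

theorem not_commute_bsConjugator_conj :
    ¬ Commute (bsConjugator * bsTranslation * bsConjugator⁻¹) bsTranslation := by
  intro h
  exact absurd (congrArg (fun e : Equiv.Perm (ℤ × ℤ) => e (0, 0)) h.eq) (by decide)

/-- `F₂ × F₂` is not subgroup separable. -/
theorem not_isLERF_freeGroup_prod : ¬ IsLERF (FreeGroup (Fin 2) × FreeGroup (Fin 2)) := by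
  rw [isLERF_iff]
  intro hL
  let a : FreeGroup (Fin 2) := FreeGroup.of 0
  let t : FreeGroup (Fin 2) := FreeGroup.of 1
  let r := t * a ^ 2 * t⁻¹ * (a ^ 3)⁻¹
  let g := t * a * t⁻¹ * a * (a * (t * a * t⁻¹))⁻¹
  let π : FreeGroup (Fin 2) →* Equiv.Perm (ℤ × ℤ) :=
    FreeGroup.lift ![bsTranslation, bsConjugator]
  have hπa : π a = bsTranslation := by simp [π, a]
  have hπt : π t = bsConjugator := by simp [π, t]
  -- Mihailova's construction: the diagonal together with the relator `r` of `BS(2,3)` in one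
  -- factor. The commutator `g` survives in `π` but dies in every finite quotient killing `r`.
  let H : Subgroup (FreeGroup (Fin 2) × FreeGroup (Fin 2)) :=
    Subgroup.closure {(a, a), (t, t), (1, r)}
  have hH : H.FG := (Subgroup.fg_iff H).2 ⟨_, rfl, by simp⟩
  have hHπ : H ≤ MonoidHom.eqLocus (π.comp (MonoidHom.fst _ _)) (π.comp (MonoidHom.snd _ _)) := by
    rw [Subgroup.closure_le]
    rintro x (rfl | rfl | rfl)
    · rfl
    · rfl
    · change π 1 = π r
      simp only [r, map_mul, map_inv, map_pow, map_one, hπa, hπt]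
      rw [bsConjugator_conj_sq, mul_inv_cancel]
  have hg : (g, 1) ∉ H := fun h => not_commute_bsConjugator_conj <| by
    have h : π g = π 1 := hHπ h
    simp only [g, map_mul, map_inv, map_one, hπa, hπt] at h
    exact mul_inv_eq_one.1 h
  obtain ⟨K, hK, hHK, hgK⟩ := hL H hH _ hg
  have hdiag : ∀ w : FreeGroup (Fin 2), (w, w) ∈ K := fun w => by
    induction w using FreeGroup.induction_on with
    | C1 => exact K.one_mem
    | of x =>
      refine hHK (Subgroup.subset_closure ?_)
      fin_cases x
      · exact .inl rfl
      · exact .inr (.inl rfl)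
    | inv_of x h => exact K.inv_mem h
    | mul x y hx hy => exact K.mul_mem hx hy
  let M := K.comap (MonoidHom.inl (FreeGroup (Fin 2)) (FreeGroup (Fin 2)))
  have hMi : M.FiniteIndex := finiteIndex_comap _ _
  have hM : ∀ w, w ∈ M ↔ (w, 1) ∈ K := fun w => Iff.rfl
  -- Conjugation by the diagonal elements of `K` realises all conjugations of the first factor.
  have : M.Normal := ⟨fun x hx w => by
    have := K.mul_mem (K.mul_mem (hdiag w) hx) (K.inv_mem (hdiag w))
    simpa [hM] using this⟩
  have hr : r ∈ M := by
    have := K.mul_mem (hdiag r) (K.inv_mem (hHK (Subgroup.subset_closure (.inr (.inr rfl)))))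
    simpa [hM] using this
  let q := QuotientGroup.mk' M
  refine hgK ((hM g).1 ((QuotientGroup.eq_one_iff g).1 ?_))
  have hqr : q r = 1 := (QuotientGroup.eq_one_iff r).2 hr
  have hc : Commute (q t * q a * (q t)⁻¹) (q a) :=
    commute_conj_of_isOfFinOrder (isOfFinOrder_of_finite _) (by
      simp only [r, map_mul, map_inv, map_pow] at hqr
      exact mul_inv_eq_one.1 hqr)
  change q g = 1
  simp only [g, map_mul, map_inv]
  exact mul_inv_eq_one.2 hc.eq

end BaumslagSolitar

/-! ### Generators and relations of `UV_n(c)` -/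

section Presentation

variable {n c : ℕ}

/-- The class of `σ_{i,t}` in `UV_n(c)`. -/
def sigma (i : Fin (n - 1)) (t : Fin c) : UV n c := PresentedGroup.of (Gen.sigma i t)

/-- The class of `ρ_i` in `UV_n(c)`. -/
def rho (c : ℕ) (i : Fin (n - 1)) : UV n c := PresentedGroup.of (Gen.rho i)

theorem mk_eq_of_isRelation {u v : FreeGroup (Gen n c)} (h : IsRelation n c u v) :
    PresentedGroup.mk (relators n c) u = PresentedGroup.mk (relators n c) v := by
  rw [← mul_inv_eq_one, ← map_inv, ← map_mul]
  exact PresentedGroup.one_of_mem ⟨u, v, h, rfl⟩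

theorem rho_braid (i j : Fin (n - 1)) (h : (i : ℕ) + 1 = j) :
    rho c i * rho c j * rho c i = rho c j * rho c i * rho c j :=
  mk_eq_of_isRelation (.pr1 i j h)

theorem rho_comm (i j : Fin (n - 1)) (h : Far i j) : rho c i * rho c j = rho c j * rho c i :=
  mk_eq_of_isRelation (.pr2 i j h)

theorem rho_sq (i : Fin (n - 1)) : rho c i ^ 2 = 1 :=
  mk_eq_of_isRelation (.pr3 i)

theorem sigma_comm (i j : Fin (n - 1)) (t l : Fin c) (h : Far i j) :
    sigma i t * sigma j l = sigma j l * sigma i t :=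
  mk_eq_of_isRelation (.cr i j t l h)

theorem sigma_rho_comm (i j : Fin (n - 1)) (t : Fin c) (h : Far i j) :
    sigma i t * rho c j = rho c j * sigma i t :=
  mk_eq_of_isRelation (.mr1 i j t h)

theorem rho_rho_sigma (i j : Fin (n - 1)) (t : Fin c) (h : (i : ℕ) + 1 = j) :
    rho c i * rho c j * sigma i t = sigma j t * rho c i * rho c j :=
  mk_eq_of_isRelation (.mr2 i j t h)

/-- A homomorphism out of `UV_n(c)` from images of the generators that satisfy the relations. -/
def liftUV {G : Type*} [Group G] (f : Gen n c → G)
    (h : ∀ u v, IsRelation n c u v → FreeGroup.lift f u = FreeGroup.lift f v) : UV n c →* G :=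
  PresentedGroup.toGroup (rels := relators n c) (f := f) <| by
    rintro r ⟨u, v, huv, rfl⟩
    rw [map_mul, map_inv, mul_inv_eq_one, h u v huv]

theorem liftUV_sigma {G : Type*} [Group G] (f : Gen n c → G)
    (h : ∀ u v, IsRelation n c u v → FreeGroup.lift f u = FreeGroup.lift f v)
    (i : Fin (n - 1)) (t : Fin c) : liftUV f h (sigma i t) = f (Gen.sigma i t) :=
  PresentedGroup.toGroup.of _

theorem liftUV_rho {G : Type*} [Group G] (f : Gen n c → G)
    (h : ∀ u v, IsRelation n c u v → FreeGroup.lift f u = FreeGroup.lift f v)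
    (i : Fin (n - 1)) : liftUV f h (rho c i) = f (Gen.rho i) :=
  PresentedGroup.toGroup.of _

end Presentation

/-! ### Virtual freeness for `n ≤ 3` -/

section VirtuallyFree

/-- A group that embeds into a semidirect product of a free group with a finite group is virtually
free. -/
theorem isVirtuallyFree_of_injective {G W N : Type*} [Group G] [Group W] [Group N] [Finite W]
    [IsFreeGroup N] {θ : W →* MulAut N} (f : G →* N ⋊[θ] W) (hf : Function.Injective f) :
    IsVirtuallyFree G := by
  let H := (SemidirectProduct.rightHom.comp f).ker
  have hr : ∀ x : H, (f x).right = 1 := fun x => x.2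
  let k : H →* N :=
    { toFun := fun x => (f x).left
      map_one' := by simp
      map_mul' := fun x y => by simp [hr] }
  have hk : Function.Injective k := fun x y h =>
    Subtype.ext (hf (SemidirectProduct.ext h ((hr x).trans (hr y).symm)))
  -- The range of `k` is free by Nielsen–Schreier.
  exact ⟨H, inferInstance, IsFreeGroup.ofMulEquiv (MonoidHom.ofInjective hk).symm⟩

/-- Left translation of the generators of the free group on `W × T`. -/
def translationAut (W T : Type*) [Group W] : W →* MulAut (FreeGroup (W × T)) where
  toFun w := FreeGroup.freeGroupCongr ((Equiv.mulLeft w).prodCongr (Equiv.refl T))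
  map_one' := by
    refine MulEquiv.toMonoidHom_injective (FreeGroup.ext_hom _ _ fun x => ?_)
    simp [FreeGroup.freeGroupCongr]
  map_mul' v w := by
    refine MulEquiv.toMonoidHom_injective (FreeGroup.ext_hom _ _ fun x => ?_)
    simp [FreeGroup.freeGroupCongr, Prod.map, mul_assoc]

theorem translationAut_of {W T : Type*} [Group W] (w : W) (x : W × T) :
    translationAut W T w (FreeGroup.of x) = FreeGroup.of (w * x.1, x.2) := by
  simp [translationAut, FreeGroup.freeGroupCongr, Prod.map]

/-- The homomorphism to `G` extending the inclusion of a subgroup `W` and sending the free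
generator `(w, t)` to `w s_t w⁻¹`. -/
def conjHom {G T : Type*} [Group G] (W : Subgroup G) (s : T → G) :
    FreeGroup (W × T) ⋊[translationAut W T] W →* G :=
  SemidirectProduct.lift (FreeGroup.lift fun x => (x.1 : G) * s x.2 * (x.1 : G)⁻¹) W.subtype
    fun w => FreeGroup.ext_hom _ _ fun x => by simp [translationAut_of, mul_assoc]

theorem inr_mul_inl_of {W T : Type*} [Group W] (w : W) (x : W × T) :
    (SemidirectProduct.inr w * SemidirectProduct.inl (FreeGroup.of x) :
      FreeGroup (W × T) ⋊[translationAut W T] W) =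
    SemidirectProduct.inl (FreeGroup.of (w * x.1, x.2)) * SemidirectProduct.inr w := by
  rw [← translationAut_of, SemidirectProduct.inl_aut]
  simp [mul_assoc]

/-- Two involutions satisfying the braid relation generate a finite group. -/
theorem finite_closure_pair_of_braid {G : Type*} [Group G] {a b : G} (ha : a ^ 2 = 1)
    (hb : b ^ 2 = 1) (hab : a * b * a = b * a * b) : Finite (Subgroup.closure {a, b}) := by
  rw [pow_two] at ha hb
  have ha' : a⁻¹ = a := inv_eq_of_mul_eq_one_left ha
  have hb' : b⁻¹ = b := inv_eq_of_mul_eq_one_left hb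
  let T : Set G := {1, a, b, a * b, b * a, a * b * a}
  have hT : T.Finite := by simp [T]
  have hTa : ∀ x ∈ T, x * a ∈ T := by
    rintro x (rfl | rfl | rfl | rfl | rfl | rfl) <;> simp [T, mul_assoc, ha]
  have hTb : ∀ x ∈ T, x * b ∈ T := by
    rintro x (rfl | rfl | rfl | rfl | rfl | rfl)
    · simp [T]
    · simp [T]
    · simp [T, hb]
    · simp [T, mul_assoc, hb]
    · simp [T, hab]
    · simp [T, hab, mul_assoc, hb]
  refine hT.subset fun x hx => ?_
  induction hx using Subgroup.closure_induction_right with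
  | one => exact .inl rfl
  | mul_right x _ y hy ih =>
    rcases hy with rfl | rfl
    exacts [hTa x ih, hTb x ih]
  | mul_inv_cancel x _ y hy ih =>
    rcases hy with rfl | rfl
    · rw [ha']
      exact hTa x ih
    · rw [hb']
      exact hTb x ih

theorem isVirtuallyFree_UV {n c : ℕ} (hn : 2 ≤ n) (hn' : n ≤ 3) : IsVirtuallyFree (UV n c) := by
  let o : Fin (n - 1) := ⟨0, by omega⟩
  -- The last index, which equals `o` when `n = 2`; this treats both values of `n` at once.
  let e : Fin (n - 1) := ⟨n - 2, by omega⟩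
  have hoe : ∀ i : Fin (n - 1), i = o ∨ i = e := fun i => by
    simp only [o, e, Fin.ext_iff]
    omega
  have hfar : ∀ i j : Fin (n - 1), ¬ Far i j := fun i j h => by
    unfold Far at h
    omega
  have hadj : ∀ i j : Fin (n - 1), (i : ℕ) + 1 = j → i = o ∧ j = e ∧ e ≠ o := fun i j h => by
    simp only [o, e, Fin.ext_iff, ne_eq]
    omega
  let W := Subgroup.closure {rho c o, rho c e}
  have : Finite W := by
    refine finite_closure_pair_of_braid (rho_sq o) (rho_sq e) ?_
    by_cases h : o = e
    · rw [← h]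
    · refine rho_braid o e ?_
      simp only [o, e, Fin.ext_iff] at h ⊢
      omega
  have hW : ∀ i, rho c i ∈ W := fun i => by
    rcases hoe i with h | h <;> rw [h] <;> exact Subgroup.subset_closure (by simp)
  let r : Fin (n - 1) → W := fun i => ⟨rho c i, hW i⟩
  -- Chosen so that `σ_{i,t} = v_i σ_{o,t} v_i⁻¹`, as the mixed relation dictates.
  let v : Fin (n - 1) → W := fun i => if i = o then 1 else r o * r e
  let θ := translationAut W (Fin c)
  let f : Gen n c → FreeGroup (W × Fin c) ⋊[θ] W
    | .sigma i t => SemidirectProduct.inl (FreeGroup.of (v i, t))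
    | .rho i => SemidirectProduct.inr (r i)
  have hf : ∀ u v, IsRelation n c u v → FreeGroup.lift f u = FreeGroup.lift f v := by
    intro x y hxy
    induction hxy with
    | pr1 i j h =>
      simp only [freeRho, map_mul, FreeGroup.lift_apply_of, f]
      simp only [← map_mul]
      exact congrArg _ (Subtype.ext (rho_braid i j h))
    | pr3 i =>
      simp only [freeRho, map_pow, FreeGroup.lift_apply_of, f, map_one]
      rw [← map_pow, ← map_one SemidirectProduct.inr]
      exact congrArg _ (Subtype.ext (rho_sq i))
    | mr2 i j t h =>
      obtain ⟨rfl, rfl, heo⟩ := hadj i j h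
      simp only [freeRho, freeSigma, map_mul, FreeGroup.lift_apply_of, f]
      rw [← map_mul SemidirectProduct.inr, inr_mul_inl_of, map_mul, ← mul_assoc]
      simp [v, heo]
    | pr2 i j h => exact absurd h (hfar i j)
    | cr i j t l h => exact absurd h (hfar i j)
    | mr1 i j t h => exact absurd h (hfar i j)
  let F := liftUV f hf
  refine isVirtuallyFree_of_injective F ?_
  have hinv : (conjHom W (sigma o)).comp F = MonoidHom.id _ := by
    refine PresentedGroup.ext fun x => ?_
    cases x with
    | sigma i t =>
      change conjHom W (sigma o) (F (sigma i t)) = sigma i t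
      rw [liftUV_sigma]
      simp only [f, conjHom, SemidirectProduct.lift_inl, FreeGroup.lift_apply_of]
      by_cases hi : i = o
      · simp [v, hi]
      · have hie := (hoe i).resolve_left hi
        simp only [v, hi, if_false]
        rw [mul_inv_eq_iff_eq_mul, hie]
        refine (rho_rho_sigma o e t ?_).trans (mul_assoc _ _ _)
        simp only [o, e, hie, Fin.ext_iff] at hi ⊢
        omega
    | rho i =>
      change conjHom W (sigma o) (F (rho c i)) = rho c i
      rw [liftUV_rho]
      simp [f, conjHom, r]
  exact Function.LeftInverse.injective (g := conjHom W (sigma o)) (DFunLike.congr_fun hinv)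

end VirtuallyFree

/-! ### The subgroup `F₂ × F₂` for `n ≥ 4` -/

section Product

/-- The value at the ordered pair `(k, l)` of the function on ordered pairs that is the first free
generator at `(p, q)`, the second one at `(q, p)`, and trivial elsewhere. -/
def letter {I : Type*} [DecidableEq I] (p q k l : I) : FreeGroup (Fin 2) :=
  if k = p ∧ l = q then FreeGroup.of 0 else if k = q ∧ l = p then FreeGroup.of 1 else 1

/-- Left multiplication by `letter p q` on the fibres over ordered pairs. -/
def letterPerm {I : Type*} [DecidableEq I] (p q : I) : Equiv.Perm (I × I × FreeGroup (Fin 2)) where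
  toFun x := (x.1, x.2.1, letter p q x.1 x.2.1 * x.2.2)
  invFun x := (x.1, x.2.1, (letter p q x.1 x.2.1)⁻¹ * x.2.2)
  left_inv x := by simp
  right_inv x := by simp

/-- The permutation of the fibres induced by a permutation of the base. -/
def pairPerm (I : Type*) : Equiv.Perm I →* Equiv.Perm (I × I × FreeGroup (Fin 2)) where
  toFun g := g.prodCongr (g.prodCongr (Equiv.refl _))
  map_one' := rfl
  map_mul' _ _ := rfl

theorem pairPerm_apply {I : Type*} (g : Equiv.Perm I) (x : I × I × FreeGroup (Fin 2)) :
    pairPerm I g x = (g x.1, g x.2.1, x.2.2) := rfl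

theorem pairPerm_mul_letterPerm {I : Type*} [DecidableEq I] (g : Equiv.Perm I) (p q : I) :
    pairPerm I g * letterPerm p q = letterPerm (g p) (g q) * pairPerm I g := by
  refine Equiv.ext fun x => ?_
  simp only [Equiv.Perm.mul_apply, pairPerm_apply, letterPerm, letter, Equiv.coe_fn_mk,
    EmbeddingLike.apply_eq_iff_eq]

/-- If the supports meet, then `{p, q} = {r, s}`; as `p ≠ s`, the two permutations coincide. -/
theorem letterPerm_comm {I : Type*} [DecidableEq I] {p q r s : I} (hps : p ≠ s) :
    letterPerm p q * letterPerm r s = letterPerm r s * letterPerm p q := by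
  refine Equiv.ext fun x => ?_
  simp only [letterPerm, letter, Equiv.Perm.mul_apply, Equiv.coe_fn_mk]
  split_ifs <;> simp_all

theorem adjSwap_left {n : ℕ} (i : Fin (n - 1)) :
    adjSwap i (⟨i, by omega⟩ : Fin n) = ⟨i + 1, by omega⟩ :=
  Equiv.swap_apply_left _ _

theorem adjSwap_right {n : ℕ} (i : Fin (n - 1)) :
    adjSwap i (⟨i + 1, by omega⟩ : Fin n) = ⟨i, by omega⟩ :=
  Equiv.swap_apply_right _ _

theorem adjSwap_of_ne {n : ℕ} (i : Fin (n - 1)) (k : Fin n) (h : (k : ℕ) ≠ i)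
    (h' : (k : ℕ) ≠ i + 1) : adjSwap i k = k :=
  Equiv.swap_apply_of_ne_of_ne (fun e => h (congrArg Fin.val e)) (fun e => h' (congrArg Fin.val e))

/-- The permutations by which the generators of `UV_n(c)` act on pairs decorated by `F₂`. -/
def genPair {n c : ℕ} : Gen n c → Equiv.Perm (Fin n × Fin n × FreeGroup (Fin 2))
  | .sigma i _ => letterPerm ⟨i, by omega⟩ ⟨i + 1, by omega⟩
  | .rho i => pairPerm (Fin n) (adjSwap i)

theorem genPair_relation {n c : ℕ} (u v : FreeGroup (Gen n c)) (h : IsRelation n c u v) :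
    FreeGroup.lift genPair u = FreeGroup.lift genPair v := by
  induction h with
  | pr1 i j h => simpa [freeRho, genPair] using congrArg (pairPerm (Fin n)) (adjSwap_braid i j h)
  | pr2 i j h => simpa [freeRho, genPair] using congrArg (pairPerm (Fin n)) (adjSwap_comm i j h)
  | pr3 i => simpa [freeRho, genPair] using congrArg (pairPerm (Fin n)) (adjSwap_sq i)
  | cr i j t l h =>
    unfold Far at h
    simp only [freeSigma, map_mul, FreeGroup.lift_apply_of, genPair]
    refine letterPerm_comm ?_
    rw [ne_eq, Fin.mk.injEq]
    omega
  | mr1 i j t h =>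
    unfold Far at h
    simp only [freeSigma, freeRho, map_mul, FreeGroup.lift_apply_of, genPair]
    rw [pairPerm_mul_letterPerm, adjSwap_of_ne, adjSwap_of_ne] <;> simp only <;> omega
  | mr2 i j t h =>
    obtain ⟨j, hj⟩ := j
    obtain rfl : (i : ℕ) + 1 = j := h
    simp only [freeSigma, freeRho, map_mul, FreeGroup.lift_apply_of, genPair]
    rw [mul_assoc, pairPerm_mul_letterPerm, ← mul_assoc, pairPerm_mul_letterPerm, mul_assoc]
    rw [adjSwap_of_ne _ ⟨i, _⟩ (by simp) (by simp; omega), adjSwap_left i,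
      adjSwap_left (⟨i + 1, hj⟩ : Fin (n - 1)), adjSwap_of_ne i _ (by simp; omega) (by simp)]
    exact (mul_assoc _ _ _).symm

/-- The action of `UV_n(c)` on pairs decorated by `F₂`. -/
def pairAction (n c : ℕ) : UV n c →* Equiv.Perm (Fin n × Fin n × FreeGroup (Fin 2)) :=
  liftUV genPair genPair_relation

variable {n c : ℕ}

/-- The images of the two free generators under the embedding attached to `i`. -/
def freePair (i : Fin (n - 1)) (t : Fin c) : Fin 2 → UV n c :=
  ![sigma i t, rho c i * sigma i t * rho c i]

/-- Conjugation by `ρ_i` exchanges `i` and `i + 1`, bringing the second letter to the pair `(i, i +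
1)`. -/
theorem pairAction_freePair (i : Fin (n - 1)) (t : Fin c) (x : Fin 2) (p : Fin n × Fin n)
    (w : FreeGroup (Fin 2)) :
    pairAction n c (freePair i t x) (p.1, p.2, w) =
      (p.1, p.2, (![letter ⟨i, by omega⟩ ⟨i + 1, by omega⟩ p.1 p.2,
        letter ⟨i + 1, by omega⟩ ⟨i, by omega⟩ p.1 p.2] x) * w) := by
  fin_cases x
  · simp [freePair, pairAction, liftUV_sigma, genPair, letterPerm]
  · change pairAction n c (rho c i * sigma i t * rho c i) _ = _
    rw [pairAction, map_mul, map_mul, liftUV_sigma, liftUV_rho, genPair, genPair,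
      pairPerm_mul_letterPerm, adjSwap_left, adjSwap_right, mul_assoc, ← map_mul, ← pow_two,
      adjSwap_sq, map_one, mul_one]
    rfl

/-- An equivariance that holds for free generators holds for the whole free group. -/
theorem apply_eq_of_generators {X Ω Ω' : Type*} (h : FreeGroup X →* Equiv.Perm Ω)
    (k : FreeGroup X →* Equiv.Perm Ω') (ι : Ω' → Ω)
    (hgen : ∀ x w, h (FreeGroup.of x) (ι w) = ι (k (FreeGroup.of x) w)) (u : FreeGroup X) :
    ∀ w, h u (ι w) = ι (k u w) := by
  induction u using FreeGroup.induction_on with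
  | C1 => simp
  | of x => exact hgen x
  | inv_of x _ =>
    intro w
    rw [map_inv, map_inv, Equiv.Perm.inv_eq_iff_eq, hgen]
    simp
  | mul u v hu hv => simp [hu, hv]

/-- The free group generated by `freePair i t` acts by left translation over its own pair. -/
theorem pairAction_lift_self (i : Fin (n - 1)) (t : Fin c) (u w : FreeGroup (Fin 2)) :
    pairAction n c (FreeGroup.lift (freePair i t) u) (⟨i, by omega⟩, ⟨i + 1, by omega⟩, w) =
      (⟨i, by omega⟩, ⟨i + 1, by omega⟩, u * w) :=
  apply_eq_of_generators ((pairAction n c).comp (FreeGroup.lift (freePair i t)))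
    (MulAction.toPermHom _ _) (fun w => (⟨i, by omega⟩, ⟨i + 1, by omega⟩, w)) (fun x w => by
      simp only [MonoidHom.comp_apply, FreeGroup.lift_apply_of, MulAction.toPermHom_apply,
        MulAction.toPerm_apply, smul_eq_mul]
      rw [pairAction_freePair i t x (_, _)]
      fin_cases x <;> simp [letter]) u w

/-- The free group generated by `freePair i t` acts trivially over a distant pair. -/
theorem pairAction_lift_of_far (i j : Fin (n - 1)) (h : Far i j) (t : Fin c)
    (u w : FreeGroup (Fin 2)) :
    pairAction n c (FreeGroup.lift (freePair i t) u) (⟨j, by omega⟩, ⟨j + 1, by omega⟩, w) =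
      (⟨j, by omega⟩, ⟨j + 1, by omega⟩, w) :=
  apply_eq_of_generators ((pairAction n c).comp (FreeGroup.lift (freePair i t)))
    1 (fun w => (⟨j, by omega⟩, ⟨j + 1, by omega⟩, w)) (fun x w => by
      unfold Far at h
      have h1 : (j : ℕ) ≠ i := by omega
      have h2 : (j : ℕ) ≠ i + 1 := by omega
      simp only [MonoidHom.comp_apply, FreeGroup.lift_apply_of, MonoidHom.one_apply,
        Equiv.Perm.one_apply]
      rw [pairAction_freePair i t x (_, _)]
      fin_cases x <;> simp [letter, h1, h2]) u w

theorem commute_lift_lift {X Y G : Type*} [Group G] {f : X → G} {g : Y → G}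
    (h : ∀ x y, Commute (f x) (g y)) (u : FreeGroup X) (v : FreeGroup Y) :
    Commute (FreeGroup.lift f u) (FreeGroup.lift g v) := by
  have hv : ∀ x, Commute (f x) (FreeGroup.lift g v) := fun x => by
    induction v using FreeGroup.induction_on with
    | C1 => simp
    | of y => simpa using h x y
    | inv_of y hy => simpa using hy
    | mul v w hv hw => simpa using hv.mul_right hw
  induction u using FreeGroup.induction_on with
  | C1 => simp
  | of x => simpa using hv x
  | inv_of x hx => simpa using hx
  | mul u w hu hw => simpa using hu.mul_left hw

theorem commute_freePair {i j : Fin (n - 1)} (h : Far i j) (t l : Fin c) (x y : Fin 2) :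
    Commute (freePair i t x) (freePair j l y) := by
  have hss : Commute (sigma i t) (sigma j l) := sigma_comm i j t l h
  have hsr : Commute (sigma i t) (rho c j) := sigma_rho_comm i j t h
  have hrs : Commute (rho c i) (sigma j l) := (sigma_rho_comm j i l h.symm).symm
  have hrr : Commute (rho c i) (rho c j) := rho_comm i j h
  have hs : Commute (sigma i t) (rho c j * sigma j l * rho c j) :=
    (hsr.mul_right hss).mul_right hsr
  have hr : Commute (rho c i) (rho c j * sigma j l * rho c j) :=
    (hrr.mul_right hrs).mul_right hrr
  fin_cases x <;> fin_cases y
  · exact hss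
  · exact hs
  · exact (hrs.mul_left hss).mul_left hrs
  · exact (hr.mul_left hs).mul_left hr

theorem lift_freePair_mem_KUV (i : Fin (n - 1)) (t : Fin c) (u : FreeGroup (Fin 2)) :
    FreeGroup.lift (freePair i t) u ∈ KUV n c := by
  have hs : piK n c (sigma i t) = 1 := PresentedGroup.toGroup.of _
  have hr : piK n c (rho c i) = adjSwap i := PresentedGroup.toGroup.of _
  induction u using FreeGroup.induction_on with
  | C1 => exact (KUV n c).one_mem
  | of x =>
    rw [FreeGroup.lift_apply_of, KUV, MonoidHom.mem_ker]
    fin_cases x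
    · exact hs
    · change piK n c (rho c i * sigma i t * rho c i) = 1
      rw [map_mul, map_mul, hs, hr, mul_one, ← pow_two, adjSwap_sq]
  | inv_of x h => simpa using h
  | mul u v hu hv => simpa using mul_mem hu hv

theorem exists_freeGroup_prod_injective_KUV (hn : 4 ≤ n) (hc : 1 ≤ c) :
    ∃ φ : FreeGroup (Fin 2) × FreeGroup (Fin 2) →* KUV n c, Function.Injective φ := by
  let i : Fin (n - 1) := ⟨0, by omega⟩
  let j : Fin (n - 1) := ⟨2, by omega⟩
  let t : Fin c := ⟨0, hc⟩
  have hij : Far i j := .inl le_rfl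
  let f := FreeGroup.lift (freePair i t)
  let g := FreeGroup.lift (freePair j t)
  let φ := MonoidHom.noncommCoprod f g (commute_lift_lift (commute_freePair hij t t))
  refine ⟨φ.codRestrict (KUV n c) fun x =>
    mul_mem (lift_freePair_mem_KUV i t x.1) (lift_freePair_mem_KUV j t x.2), ?_⟩
  rw [injective_iff_map_eq_one]
  rintro ⟨u, v⟩ h
  have h : f u * g v = 1 := congrArg Subtype.val h
  have h1 := congrArg (pairAction n c) h
  rw [map_mul, map_one] at h1
  -- The fibre over `(i, i + 1)` reads off `u`, and the one over `(j, j + 1)` reads off `v`.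
  have hu := DFunLike.congr_fun h1 ((⟨i, by omega⟩, ⟨i + 1, by omega⟩, 1) : Fin n × Fin n × _)
  have hv := DFunLike.congr_fun h1 ((⟨j, by omega⟩, ⟨j + 1, by omega⟩, 1) : Fin n × Fin n × _)
  rw [Equiv.Perm.mul_apply, pairAction_lift_of_far j i hij.symm, pairAction_lift_self] at hu
  rw [Equiv.Perm.mul_apply, pairAction_lift_self, pairAction_lift_of_far i j hij] at hv
  simpa using And.intro hu hv

end Product

/-! ### Separability of `UV_n(c)` and `PUV_n(c)` -/

theorem isLERF_UV_iff {n c : ℕ} (hn : 2 ≤ n) (hc : 1 ≤ c) :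
    IsLERF (UV n c) ↔ n = 2 ∨ n = 3 := by
  refine ⟨fun h => ?_, fun h => (isVirtuallyFree_UV hn (by omega)).isLERF⟩
  by_contra hn'
  obtain ⟨φ, hφ⟩ := exists_freeGroup_prod_injective_KUV (n := n) (by omega) hc
  exact not_isLERF_freeGroup_prod
    ((h.of_injective (KUV n c).subtype (KUV n c).subtype_injective).of_injective φ hφ)

theorem isLERF_PUV_iff_isLERF_UV (n c : ℕ) : IsLERF (PUV n c) ↔ IsLERF (UV n c) := by
  have : (PUV n c).FiniteIndex := Subgroup.finiteIndex_ker (piP n c)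
  exact ⟨fun h => h.of_finiteIndex,
    fun h => h.of_injective (PUV n c).subtype (PUV n c).subtype_injective⟩

end UnivVirtualBraid

theorem mainTheorem4 (n c : ℕ) (hn : 2 ≤ n) (hc : 1 ≤ c) :
    (UnivVirtualBraid.IsLERF (UnivVirtualBraid.UV n c) ↔ n = 2 ∨ n = 3) ∧
    (UnivVirtualBraid.IsLERF (UnivVirtualBraid.PUV n c) ↔ n = 2 ∨ n = 3) ∧
    (n ≤ 3 → UnivVirtualBraid.IsVirtuallyFree (UnivVirtualBraid.UV n c)) ∧
    (4 ≤ n → ∃ φ : FreeGroup (Fin 2) × FreeGroup (Fin 2) →* UnivVirtualBraid.KUV n c,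
      Function.Injective φ) ∧
    ¬ UnivVirtualBraid.IsLERF (FreeGroup (Fin 2) × FreeGroup (Fin 2)) :=
  ⟨UnivVirtualBraid.isLERF_UV_iff hn hc,
    (UnivVirtualBraid.isLERF_PUV_iff_isLERF_UV n c).trans (UnivVirtualBraid.isLERF_UV_iff hn hc),
    UnivVirtualBraid.isVirtuallyFree_UV hn,
    fun h => UnivVirtualBraid.exists_freeGroup_prod_injective_KUV h hc,
    UnivVirtualBraid.not_isLERF_freeGroup_prod⟩
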